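/- Let $X$ be a paracompact Hausdorff space and let $\mathfrak U$ be its universal (fine) uniformity, i.e. the finest uniformity on $X$ compatible with the topology of $X$. Let $\mathcal O_X$ be the collection of all non-trivial open covers of $X$, where a cover $\mathscr U$ is non-trivial if $X \notin \mathscr U$. Let $\mathcal C_{\mathfrak U}(X)$ be the collection of all non-trivial open uniform covers of $X$, i.e. of all families $\mathscr U$ of open sets with $X \notin \mathscr U$ for which there is an entourage $E \in \mathfrak U$ such that every set $E[x] = \{y : (x,y) \in E\}$, $x \in X$, is contained in a member of $\mathscr U$. For collections $\mathcal A, \mathcal B$ of sets, in the game $\mathsf G_1(\mathcal A, \mathcal B)$ (respectively $\mathsf G_{\mathrm{fin}}(\mathcal A, \mathcal B)$) players One and Two play one round for each $n \in \omega$: One plays $A_n \in \mathcal A$, and Two answers with an element $x_n \in A_n$ (respectively a finite subset $\mathcal F_n \subseteq A_n$). Two wins if $\{x_n : n \in \omega\} \in \mathcal B$ (respectively $\bigcup_{n} \mathcal F_n \in \mathcal B$); otherwise One wins. A strategy for One is a function giving a move $A_n \in \mathcal A$ for each finite sequence of previous moves of Two; it is predetermined if it depends only on the turn number, i.e. if it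 is a function $\omega \to \mathcal A$; it is winning if One wins every play that follows it. Then, for each $\square \in \{1, \mathrm{fin}\}$, One has a predetermined winning strategy in $\mathsf G_\square(\mathcal C_{\mathfrak U}(X), \mathcal O_X)$ if and only if One has a winning strategy in $\mathsf G_\square(\mathcal C_{\mathfrak U}(X), \mathcal O_X)$. -/

import Mathlib

open Set

/-! ### Selection games -/

section Games

variable {α : Type*}

/-- A strategy for player One in the single-selection game `G₁(𝒜, ℬ)`: a function
`(⋃ 𝒜)^{<ω} → 𝒜` from the finite sequences of moves of Two so far to moves of One. -/
abbrev StrategyOneSingle (𝒜 : Set (Set α)) : Type _ :=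
  List (⋃₀ 𝒜 : Set α) → 𝒜

/-- `σ` is winning in `G₁(𝒜, ℬ)`: whenever `xₙ ∈ σ⟨x₀, …, xₙ₋₁⟩` for all `n`,
the set `{xₙ : n ∈ ω}` is not in `ℬ`. -/
def StrategyOneSingle.IsWinning {𝒜 : Set (Set α)} (σ : StrategyOneSingle 𝒜)
    (ℬ : Set (Set α)) : Prop :=
  ∀ x : ℕ → (⋃₀ 𝒜 : Set α),
    (∀ n : ℕ, (x n : α) ∈ (σ (List.ofFn fun k : Fin n => x k) : Set α)) →
      range (fun n => (x n : α)) ∉ ℬ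

/-- One has a winning strategy in `G₁(𝒜, ℬ)`. -/
def OneWinsSingle (𝒜 ℬ : Set (Set α)) : Prop :=
  ∃ σ : StrategyOneSingle 𝒜, σ.IsWinning ℬ

/-- One has a predetermined winning strategy in `G₁(𝒜, ℬ)`: a function `σ : ω → 𝒜`,
depending on the turn number only, that wins against every play of Two. -/
def OnePreWinsSingle (𝒜 ℬ : Set (Set α)) : Prop :=
  ∃ σ : ℕ → 𝒜, ∀ x : ℕ → α, (∀ n : ℕ, x n ∈ (σ n : Set α)) → range x ∉ ℬ

/-- The possible moves of Two in the finite-selection game `G_fin(𝒜, ℬ)`: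
the finite subsets of members of `𝒜`. -/
abbrev FiniteMove (𝒜 : Set (Set α)) : Type _ :=
  {F : Finset α // ∃ A ∈ 𝒜, (F : Set α) ⊆ A}

/-- A strategy for player One in the finite-selection game `G_fin(𝒜, ℬ)`. -/
abbrev StrategyOneFin (𝒜 : Set (Set α)) : Type _ :=
  List (FiniteMove 𝒜) → 𝒜

/-- `σ` is winning in `G_fin(𝒜, ℬ)`: whenever `Fₙ` is a finite subset of
`σ⟨F₀, …, Fₙ₋₁⟩` for all `n`, the set `⋃ₙ Fₙ` is not in `ℬ`. -/
def StrategyOneFin.IsWinning {𝒜 : Set (Set α)} (σ : StrategyOneFin 𝒜)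
    (ℬ : Set (Set α)) : Prop :=
  ∀ F : ℕ → FiniteMove 𝒜,
    (∀ n : ℕ, ((F n).1 : Set α) ⊆ (σ (List.ofFn fun k : Fin n => F k) : Set α)) →
      (⋃ n, ((F n).1 : Set α)) ∉ ℬ

/-- One has a winning strategy in `G_fin(𝒜, ℬ)`. -/
def OneWinsFin (𝒜 ℬ : Set (Set α)) : Prop :=
  ∃ σ : StrategyOneFin 𝒜, σ.IsWinning ℬ

/-- One has a predetermined winning strategy in `G_fin(𝒜, ℬ)`. -/
def OnePreWinsFin (𝒜 ℬ : Set (Set α)) : Prop :=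
  ∃ σ : ℕ → 𝒜, ∀ F : ℕ → Finset α, (∀ n : ℕ, (F n : Set α) ⊆ (σ n : Set α)) →
    (⋃ n, (F n : Set α)) ∉ ℬ

end Games

/-! ### Covers and the universal uniformity -/

section Covers

/-- `𝒪_X`: the non-trivial open covers of `X`, that is, those without `X` as a member. -/
def nontrivialOpenCovers (X : Type*) [TopologicalSpace X] : Set (Set (Set X)) :=
  {𝒰 | (∀ U ∈ 𝒰, IsOpen U) ∧ ⋃₀ 𝒰 = univ ∧ univ ∉ 𝒰}

/-- `𝒞_𝓔(X)`: the non-trivial open uniform covers of the uniform space `(X, 𝓔)`. A family `𝒰`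
is a uniform cover if, for some entourage `E`, every `E[x] = {y | (x, y) ∈ E}` lies in a member
of `𝒰`; open sets are those of the topology generated by `𝓔`. -/
def nontrivialOpenUniformCovers {X : Type*} (𝓔 : UniformSpace X) : Set (Set (Set X)) :=
  {𝒰 | (∀ U ∈ 𝒰, @IsOpen X 𝓔.toTopologicalSpace U) ∧
    (∃ E ∈ 𝓔.uniformity, ∀ x : X, ∃ U ∈ 𝒰, {y | (x, y) ∈ E} ⊆ U) ∧ univ ∉ 𝒰}

/-- The universal (fine) uniformity on `X`: the finest uniformity compatible with the topology,
as the infimum of all compatible uniformities (`u ≤ v` means that `u` is finer than `v`).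
See `universalUniformity_isLeast`. -/
@[reducible] def universalUniformity (X : Type*) [t : TopologicalSpace X] : UniformSpace X :=
  sInf {u : UniformSpace X | u.toTopologicalSpace = t}

/-- On a paracompact Hausdorff space, `universalUniformity X` is compatible with the topology,
and it is finer than every compatible uniformity. -/
theorem universalUniformity_isLeast (X : Type*) [t : TopologicalSpace X] [T2Space X]
    [ParacompactSpace X] :
    IsLeast {u : UniformSpace X | u.toTopologicalSpace = t} (universalUniformity X) := by
  refine ⟨?_, fun u hu => sInf_le hu⟩
  obtain ⟨u, hu⟩ := CompletelyRegularSpace.exists_uniformSpace (X := X)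
  change (sInf {u : UniformSpace X | u.toTopologicalSpace = t}).toTopologicalSpace = t
  rw [UniformSpace.toTopologicalSpace_sInf]
  refine le_antisymm (iInf₂_le_of_le u hu (le_of_eq hu)) ?_
  exact le_iInf₂ fun v hv => le_of_eq (Eq.symm hv)

end Covers

/-!
On a paracompact Hausdorff space every open cover is uniform for the universal uniformity, so
`𝒞_𝔘(X) = 𝒪_X` (`nontrivialOpenUniformCovers_universalUniformity`): a locally finite refinement
with a closed shrinking produces small neighborhoods of the diagonal, and hence the neighborhoods
of the diagonal form a compatible uniformity. What remains are the theorems of Hurewicz and of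
Pawlikowski: if One has no predetermined winning strategy, which says that `X` is a Menger
(respectively Rothberger) space, then no strategy of One is winning.

*Hurewicz.* A Menger space is Lindelöf, so a strategy of One becomes a tree `c` of countable covers
indexed by `List ℕ`, which are increasing since Two may select finite sets. On each level of the
tree, the sets of points covered so far form a tail cover: every point has a neighborhood contained
in all but finitely many of them (`exists_nhds_finite_not_subset_coveredAlong`). Intersecting all
but finitely many of these sets gives a directed open cover for each level, and the Menger property
yields a cofinite part of each level such that the intersections of these parts cover `X`. A branch
that stays inside the cofinite parts is a play won by Two. If only indices `≥ i` are counted as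
covering a point, for every `i`, then the branch covers each point infinitely often
(`IsMenger.exists_branch_frequently_mem`).

*Pawlikowski.* For a tree `u` of countable open covers of a Rothberger space, Hurewicz's theorem
gives a bound `g` for the branch, such that each point lies, on infinitely many levels `n`, in a
finite intersection of sets `u t (φ t)`, one for every node `t ≤ g` of level `n`, with `φ t ≤ g n`.
In a Rothberger space one such `φ` can be chosen on each level so that the chosen intersections
cover `X` (`IsRothberger.exists_selection_of_frequently`); following the chosen `φ` gives the
branch (`IsRothberger.exists_branch_mem`).
-/

/-! ### Open covers of a paracompact Hausdorff space are uniform -/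

open Filter Topology in
/-- An open cover of a paracompact Hausdorff space has a neighborhood `W` of the diagonal all of
whose two-sided balls `{x | (x, y) ∈ W ∨ (y, x) ∈ W}` lie in members of the cover. -/
theorem exists_mem_nhdsSet_diagonal_subordinate {X : Type*} [TopologicalSpace X] [T2Space X]
    [ParacompactSpace X] {𝒰 : Set (Set X)} (ho : ∀ U ∈ 𝒰, IsOpen U) (hc : ⋃₀ 𝒰 = univ) :
    ∃ W ∈ 𝓝ˢ (diagonal X), ∀ y, ∃ U ∈ 𝒰, ∀ x, (x, y) ∈ W ∨ (y, x) ∈ W → x ∈ U := by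
  obtain ⟨V, Vo, Vc, Vf, VU⟩ := precise_refinement (fun U : 𝒰 => (U : Set X))
    (fun U => ho U U.2) (by rwa [← sUnion_eq_iUnion])
  obtain ⟨K, Kc, Kcl, KV⟩ :=
    exists_iUnion_eq_closed_subset Vo (fun x => Vf.point_finite x) Vc
  let W : Set (X × X) := {p | ∀ i, (p.1 ∈ V i ∧ p.2 ∈ V i) ∨ (p.1 ∉ K i ∧ p.2 ∉ K i)}
  refine ⟨W, ?_, fun y => ?_⟩
  · rw [nhdsSet_diagonal, mem_iSup]
    intro x
    obtain ⟨N, hN, hfin⟩ := Vf x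
    have hi : ∀ i, {p : X × X | (p.1 ∈ V i ∧ p.2 ∈ V i) ∨ (p.1 ∉ K i ∧ p.2 ∉ K i)} ∈ 𝓝 (x, x) := by
      intro i
      by_cases hx : x ∈ K i
      · have hV : V i ∈ 𝓝 x := (Vo i).mem_nhds (KV i hx)
        filter_upwards [prod_mem_nhds hV hV] with p hp using Or.inl hp
      · have hK : (K i)ᶜ ∈ 𝓝 x := (Kcl i).isOpen_compl.mem_nhds hx
        filter_upwards [prod_mem_nhds hK hK] with p hp using Or.inr hp
    have h2 := (biInter_mem hfin).2 fun i _ => hi i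
    filter_upwards [h2, prod_mem_nhds hN hN] with p hp hpN i
    by_cases hVN : (V i ∩ N).Nonempty
    · exact mem_iInter₂.1 hp i hVN
    · exact Or.inr ⟨fun h => hVN ⟨p.1, KV i h, hpN.1⟩, fun h => hVN ⟨p.2, KV i h, hpN.2⟩⟩
  · obtain ⟨i, hy⟩ := mem_iUnion.1 (Kc.symm ▸ mem_univ y : y ∈ ⋃ i, K i)
    refine ⟨i, i.2, fun x hx => VU i ?_⟩
    rcases hx with hx | hx
    · exact ((hx i).resolve_right fun h => h.2 hy).1
    · exact ((hx i).resolve_right fun h => h.1 hy).2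

open Filter Topology in
/-- The uniformity on a paracompact Hausdorff space whose entourages are all the neighborhoods of
the diagonal. -/
@[reducible] def diagonalUniformSpace (X : Type*) [t : TopologicalSpace X] [T2Space X]
    [ParacompactSpace X] : UniformSpace X where
  toTopologicalSpace := t
  uniformity := 𝓝ˢ (diagonal X)
  symm := continuous_swap.tendsto_nhdsSet fun _ h => Eq.symm h
  comp := by
    refine le_def.2 fun V hV => ?_
    have hc : ⋃₀ {U : Set X | IsOpen U ∧ U ×ˢ U ⊆ V} = univ := by
      refine eq_univ_of_forall fun x => ?_
      have hx : V ∈ 𝓝 (x, x) := by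
        rw [nhdsSet_diagonal, mem_iSup] at hV
        exact hV x
      obtain ⟨A, B, hA, hxA, hB, hxB, hAB⟩ := mem_nhds_prod_iff'.1 hx
      exact ⟨A ∩ B, ⟨hA.inter hB, (prod_mono inter_subset_left inter_subset_right).trans hAB⟩,
        hxA, hxB⟩
    obtain ⟨W, hW, h⟩ := exists_mem_nhdsSet_diagonal_subordinate (fun U hU => hU.1) hc
    refine mem_of_superset (mem_lift' hW) ?_
    rintro ⟨x, z⟩ ⟨y, hxy, hyz⟩
    obtain ⟨U, hU, hUy⟩ := h y
    exact hU.2 ⟨hUy x (Or.inl hxy), hUy z (Or.inr hyz)⟩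
  nhds_eq_comap_uniformity x := by
    apply le_antisymm
    · have : Tendsto (Prod.mk x) (𝓝 x) (𝓝 (x, x)) := (Continuous.prodMk_right x).tendsto x
      exact (this.mono_right (nhds_le_nhdsSet (mem_diagonal x))).le_comap
    · refine le_def.2 fun N hN => ?_
      have hc : ⋃₀ {interior N, {x}ᶜ} = univ := by
        refine eq_univ_of_forall fun y => ?_
        by_cases hy : y = x
        · exact ⟨interior N, by simp, hy ▸ mem_interior_iff_mem_nhds.2 hN⟩
        · exact ⟨{x}ᶜ, by simp, hy⟩
      obtain ⟨W, hW, h⟩ := exists_mem_nhdsSet_diagonal_subordinate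
        (by rintro U (rfl | rfl); exacts [isOpen_interior, isOpen_compl_singleton]) hc
      refine mem_comap.2 ⟨W, hW, fun y hy => ?_⟩
      obtain ⟨U, hU | hU, hUx⟩ := h x
      · exact interior_subset (hU ▸ hUx y (Or.inr hy))
      · -- the ball around `x` contains `x`, so it is not inside `{x}ᶜ`
        have : x ∈ U := hUx x (Or.inl (subset_of_mem_nhdsSet hW rfl))
        rw [hU] at this
        exact absurd rfl this

/-- Every open cover is uniform, as the neighborhoods of the diagonal form a compatible uniformity
and the universal one is finer. -/
theorem nontrivialOpenUniformCovers_universalUniformity (X : Type*) [TopologicalSpace X]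
    [T2Space X] [ParacompactSpace X] :
    nontrivialOpenUniformCovers (universalUniformity X) = nontrivialOpenCovers X := by
  have ht := (universalUniformity_isLeast X).1
  ext 𝒰
  simp only [nontrivialOpenUniformCovers, nontrivialOpenCovers, mem_ofPred_eq] at ht ⊢
  rw [ht]
  refine and_congr_right fun ho => and_congr_left fun _ => ⟨?_, fun hc => ?_⟩
  · rintro ⟨E, hE, h⟩
    refine eq_univ_of_forall fun x => ?_
    obtain ⟨U, hU, hEU⟩ := h x
    exact ⟨U, hU, hEU (@refl_mem_uniformity X (universalUniformity X) x E hE)⟩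
  · obtain ⟨W, hW, h⟩ := exists_mem_nhdsSet_diagonal_subordinate ho hc
    have hle : universalUniformity X ≤ diagonalUniformSpace X :=
      (universalUniformity_isLeast X).2 rfl
    refine ⟨W, hle hW, fun x => ?_⟩
    obtain ⟨U, hU, hx⟩ := h x
    exact ⟨U, hU, fun y hy => hx y (Or.inr hy)⟩

/-! ### Finite histories -/

section Histories

variable {α β : Type*}

/-- The list `⟨f 0, …, f (n - 1)⟩`. -/
abbrev initialSegment (f : ℕ → α) (n : ℕ) : List α :=
  List.ofFn fun k : Fin n => f k

theorem initialSegment_succ (f : ℕ → α) (n : ℕ) :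
    initialSegment f (n + 1) = initialSegment f n ++ [f n] := by
  rw [initialSegment, List.ofFn_succ_last]
  rfl

theorem take_initialSegment (f : ℕ → α) {m n : ℕ} (h : m ≤ n) :
    (initialSegment f n).take m = initialSegment f m := by
  apply List.ext_getElem
  · simp [h]
  · intro i h₁ h₂
    simp

theorem exists_forall_eq_initialSegment (φ : List α → α) :
    ∃ f : ℕ → α, ∀ n, f n = φ (initialSegment f n) := by
  let hist : ℕ → List α := fun n => n.rec [] fun _ l => l ++ [φ l]
  refine ⟨fun n => φ (hist n), fun n => ?_⟩
  suffices h : ∀ n, initialSegment (fun n => φ (hist n)) n = hist n by rw [h]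
  intro n
  induction n with
  | zero => simp [initialSegment, hist]
  | succ n ih => rw [initialSegment_succ, ih]

/-- The history of a play in which a player with response function `next` encodes the moves by
elements of `β`: after the history `l`, the code `k` stands for the move `next l k`. -/
def decodeHistory (next : List α → β → α) (s : List β) : List α :=
  s.foldl (fun l k => l ++ [next l k]) []

theorem initialSegment_decodeHistory (next : List α → β → α) (f : ℕ → β) (n : ℕ) :
    initialSegment (fun m => next (decodeHistory next (initialSegment f m)) (f m)) n =
      decodeHistory next (initialSegment f n) := by
  induction n with
  | zero => simp [initialSegment, decodeHistory]
  | succ n ih =>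
    rw [initialSegment_succ, ih, initialSegment_succ]
    simp only [decodeHistory, List.foldl_append, List.foldl_cons, List.foldl_nil]

end Histories

/-! ### Menger spaces and Hurewicz's theorem -/

section Menger

variable {X : Type*}

/-- For a tree `c` of sets, the points covered along the branch `s` by a choice of index at
least `i`. -/
def coveredAlong (c : List ℕ → ℕ → Set X) (i : ℕ) (s : List ℕ) : Set X :=
  {x | ∃ t k, t ++ [k] <+: s ∧ i ≤ k ∧ x ∈ c t k}

theorem exists_of_mem_coveredAlong_initialSegment {c : List ℕ → ℕ → Set X} {i : ℕ} {f : ℕ → ℕ}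
    {n : ℕ} {x : X} (h : x ∈ coveredAlong c i (initialSegment f n)) :
    ∃ m, i ≤ f m ∧ x ∈ c (initialSegment f m) (f m) := by
  obtain ⟨t, k, hp, hik, hx⟩ := h
  have hl : t.length + 1 ≤ n := by simpa using hp.length_le
  have he := List.prefix_iff_eq_take.1 hp
  rw [List.length_append, List.length_singleton, take_initialSegment f hl,
    initialSegment_succ] at he
  obtain ⟨ht, hk⟩ := List.append_inj' he rfl
  obtain rfl : k = f t.length := by simpa using hk
  exact ⟨t.length, hik, ht ▸ hx⟩

variable [TopologicalSpace X]

/-- The Menger property `S_fin(𝒪, 𝒪)`, for all open covers, including those with `X` as a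
member. -/
def IsMenger (X : Type*) [TopologicalSpace X] : Prop :=
  ∀ 𝒰 : ℕ → Set (Set X), (∀ n, ∀ U ∈ 𝒰 n, IsOpen U) → (∀ n, ⋃₀ 𝒰 n = univ) →
    ∃ F : ℕ → Finset (Set X), (∀ n, (F n : Set (Set X)) ⊆ 𝒰 n) ∧
      ∀ x, ∃ n, ∃ U ∈ F n, x ∈ U

/-- Menger spaces are Lindelöf. -/
theorem IsMenger.exists_seq_mem [Nonempty X] (hX : IsMenger X) {𝒰 : Set (Set X)}
    (ho : ∀ U ∈ 𝒰, IsOpen U) (hc : ⋃₀ 𝒰 = univ) :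
    ∃ e : ℕ → Set X, (∀ n, e n ∈ 𝒰) ∧ ∀ x, ∃ n, x ∈ e n := by
  obtain ⟨F, hF, hFc⟩ := hX (fun _ => 𝒰) (fun _ => ho) fun _ => hc
  have hne : (⋃ n, (F n : Set (Set X))).Nonempty := by
    obtain ⟨n, U, hU, -⟩ := hFc (Classical.arbitrary X)
    exact ⟨U, mem_iUnion.2 ⟨n, hU⟩⟩
  obtain ⟨e, he⟩ := (countable_iUnion fun n => (F n).countable_toSet).exists_eq_range hne
  refine ⟨e, fun n => ?_, fun x => ?_⟩
  · obtain ⟨m, hm⟩ := mem_iUnion.1 (he ▸ mem_range_self n : e n ∈ ⋃ n, (F n : Set (Set X)))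
    exact hF m hm
  · obtain ⟨n, U, hU, hx⟩ := hFc x
    obtain ⟨k, rfl⟩ := (he ▸ mem_iUnion.2 ⟨n, hU⟩ : U ∈ range e)
    exact ⟨k, hx⟩

/-- The Menger property for countably many open covers that are directed by inclusion: one member
of each suffices. -/
theorem IsMenger.exists_of_directed (hX : IsMenger X) {ι : Type*} [Nonempty ι]
    {W : ℕ → ι → Set X} (ho : ∀ n i, IsOpen (W n i)) (hd : ∀ n, Directed (· ⊆ ·) (W n))
    (hc : ∀ n x, ∃ i, x ∈ W n i) : ∃ g : ℕ → ι, ∀ x, ∃ n, x ∈ W n (g n) := by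
  obtain ⟨F, hF, hFc⟩ := hX (fun n => range (W n)) (fun n => by rintro _ ⟨i, rfl⟩; exact ho n i)
    fun n => eq_univ_of_forall fun x => by
      obtain ⟨i, hi⟩ := hc n x
      exact ⟨_, mem_range_self i, hi⟩
  have h : ∀ n, ∃ i, ∀ U ∈ F n, U ⊆ W n i := fun n => by
    classical
    have : ∀ U : F n, ∃ i, W n i = U := fun U => hF n U.2
    choose j hj using this
    obtain ⟨i, hi⟩ := (hd n).finset_le (Finset.univ.image j)
    refine ⟨i, fun U hU => ?_⟩
    have h : W n (j ⟨U, hU⟩) = U := hj ⟨U, hU⟩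
    exact h.symm.subset.trans (hi _ (Finset.mem_image_of_mem _ (Finset.mem_univ _)))
  choose g hg using h
  refine ⟨g, fun x => ?_⟩
  obtain ⟨n, U, hU, hx⟩ := hFc x
  exact ⟨n, hg n U hU hx⟩

open Topology in
/-- On every level of a tree of increasing open covers, the sets of points covered so far form a
tail cover: each point has a neighborhood contained in all but finitely many of them. -/
theorem exists_nhds_finite_not_subset_coveredAlong {c : List ℕ → ℕ → Set X}
    (ho : ∀ s k, IsOpen (c s k)) (hm : ∀ s, Monotone (c s)) (hc : ∀ s x, ∃ k, x ∈ c s k)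
    (i n : ℕ) (x : X) :
    ∃ N ∈ 𝓝 x, {s : List ℕ | s.length = n ∧ ¬ N ⊆ coveredAlong c i s}.Finite := by
  induction n with
  | zero =>
    refine ⟨univ, Filter.univ_mem, (finite_singleton []).subset fun s hs => ?_⟩
    exact List.length_eq_zero_iff.1 hs.1
  | succ n ih =>
    obtain ⟨N, hN, hfin⟩ := ih
    choose κ hκ using fun s => hc s x
    let k : List ℕ → ℕ := fun s => max i (κ s)
    have hk : ∀ s, c s (k s) ∈ 𝓝 x := fun s =>
      (ho s _).mem_nhds (hm s (le_max_right _ _) (hκ s))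
    refine ⟨N ∩ ⋂ s ∈ {s : List ℕ | s.length = n ∧ ¬ N ⊆ coveredAlong c i s}, c s (k s),
      Filter.inter_mem hN ((Filter.biInter_mem hfin).2 fun s _ => hk s), ?_⟩
    -- only extensions of the finitely many exceptions by finitely many indices are exceptions
    refine (hfin.biUnion fun s _ => (finite_lt_nat (k s)).image fun j => s ++ [j]).subset ?_
    rintro s' ⟨hl, hs'⟩
    obtain ⟨s, j, rfl⟩ := List.eq_nil_or_concat' s' |>.resolve_left (by rintro rfl; simp at hl)
    have hl' : s.length = n := by simpa using hl
    by_cases hs : N ⊆ coveredAlong c i s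
    · refine absurd (fun y hy => ?_) hs'
      obtain ⟨t, k, hp, h⟩ := hs hy.1
      exact ⟨t, k, hp.trans (List.prefix_append s [j]), h⟩
    · refine mem_biUnion (show s ∈ {s : List ℕ | _} from ⟨hl', hs⟩) ⟨j, ?_, rfl⟩
      by_contra hj
      refine hs' fun y hy => ⟨s, j, List.prefix_rfl, (le_max_left _ _).trans (not_lt.1 hj), ?_⟩
      exact hm s (not_lt.1 hj) (mem_iInter₂.1 hy.2 s ⟨hl', hs⟩)

/-- Hurewicz's theorem, for a tree of increasing open covers: some branch covers every point
infinitely often. -/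
theorem IsMenger.exists_branch_frequently_mem (hX : IsMenger X) {c : List ℕ → ℕ → Set X}
    (ho : ∀ s k, IsOpen (c s k)) (hm : ∀ s, Monotone (c s)) (hc : ∀ s x, ∃ k, x ∈ c s k) :
    ∃ f : ℕ → ℕ, ∀ x, ∃ᶠ n in Filter.atTop, x ∈ c (initialSegment f n) (f n) := by
  -- the intersections of cofinite parts of the tail cover on level `n + 1`
  let W : ℕ → ℕ → Finset (List ℕ) → Set X := fun i n F =>
    interior {x | ∀ s : List ℕ, s.length = n + 1 → s ∉ F → x ∈ coveredAlong c i s}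
  have hWm : ∀ i n, Monotone (W i n) := fun i n F G hFG =>
    interior_mono fun x hx s hl hs => hx s hl fun h => hs (hFG h)
  have hWc : ∀ i n x, ∃ F, x ∈ W i n F := fun i n x => by
    obtain ⟨N, hN, hfin⟩ := exists_nhds_finite_not_subset_coveredAlong ho hm hc i (n + 1) x
    refine ⟨hfin.toFinset, mem_interior_iff_mem_nhds.2 (Filter.mem_of_superset hN ?_)⟩
    intro y hy s hl hs
    by_contra h
    exact hs (hfin.mem_toFinset.2 ⟨hl, fun hsub => h (hsub hy)⟩)
  -- levels are distributed over the thresholds `i` by the pairing function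
  have hg : ∀ i, ∃ g : ℕ → Finset (List ℕ), ∀ x, ∃ j, x ∈ W i (Nat.pair i j) (g j) := fun i =>
    hX.exists_of_directed (W := fun j => W i (Nat.pair i j)) (fun _ _ => isOpen_interior)
      (fun j => (hWm i (Nat.pair i j)).directed_le) fun j x => hWc i (Nat.pair i j) x
  choose g hg using hg
  let B : ℕ → Finset (List ℕ) := fun m => g m.unpair.1 m.unpair.2
  have hB : ∀ s : List ℕ, ∃ k, s ++ [k] ∉ B s.length := fun s => by
    by_contra! h
    have hinj : Function.Injective fun k : ℕ => s ++ [k] := fun a b hab => by simpa using hab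
    exact infinite_range_of_injective hinj
      ((B s.length).finite_toSet.subset (range_subset_iff.2 h))
  choose φ hφ using hB
  obtain ⟨f, hf⟩ := exists_forall_eq_initialSegment φ
  have hfB : ∀ m, initialSegment f (m + 1) ∉ B m := fun m => by
    have := hφ (initialSegment f m)
    rwa [← hf m, ← initialSegment_succ, List.length_ofFn] at this
  refine ⟨f, fun x => ?_⟩
  have hi : ∀ i, ∃ m, i ≤ f m ∧ x ∈ c (initialSegment f m) (f m) := fun i => by
    obtain ⟨j, hj⟩ := hg i x
    refine exists_of_mem_coveredAlong_initialSegment (n := Nat.pair i j + 1)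
      (interior_subset hj _ (by simp) ?_)
    simpa [B] using hfB (Nat.pair i j)
  -- finitely many levels only allow for bounded indices
  rw [Filter.frequently_atTop]
  intro N
  obtain ⟨m, hm, hx⟩ := hi (∑ m ∈ Finset.range N, f m + 1)
  refine ⟨m, not_lt.1 fun hlt => ?_, hx⟩
  have := Finset.single_le_sum (f := f) (fun _ _ => Nat.zero_le _) (Finset.mem_range.2 hlt)
  omega

end Menger

/-! ### Rothberger spaces and Pawlikowski's theorem -/

section Rothberger

variable {X : Type*} [TopologicalSpace X]

/-- The Rothberger property `S₁(𝒪, 𝒪)`, for all open covers, including those with `X` as a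
member. -/
def IsRothberger (X : Type*) [TopologicalSpace X] : Prop :=
  ∀ 𝒰 : ℕ → Set (Set X), (∀ n, ∀ U ∈ 𝒰 n, IsOpen U) → (∀ n, ⋃₀ 𝒰 n = univ) →
    ∃ V : ℕ → Set X, (∀ n, V n ∈ 𝒰 n) ∧ ∀ x, ∃ n, x ∈ V n

theorem IsRothberger.isMenger (hX : IsRothberger X) : IsMenger X := fun 𝒰 ho hc => by
  obtain ⟨V, hV, hVc⟩ := hX 𝒰 ho hc
  exact ⟨fun n => {V n}, fun n => by simpa using hV n, fun x => by simpa using hVc x⟩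

/-- In a Rothberger space, one set can be selected from each of countably many open families so
as to cover the space, provided that every point is covered by infinitely many of the families. -/
theorem IsRothberger.exists_selection_of_frequently (hX : IsRothberger X)
    {𝒱 : ℕ → Set (Set X)} (ho : ∀ n, ∀ V ∈ 𝒱 n, IsOpen V) (hne : ∀ n, (𝒱 n).Nonempty)
    (hc : ∀ x, ∃ᶠ n in Filter.atTop, ∃ V ∈ 𝒱 n, x ∈ V) :
    ∃ V : ℕ → Set X, (∀ n, V n ∈ 𝒱 n) ∧ ∀ x, ∃ n, x ∈ V n := by
  classical
  -- the `j`-th cover consists of intersections of members of `j + 1` distinct families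
  let 𝒲 : ℕ → Set (Set X) := fun j =>
    {W | ∃ (I : Finset ℕ) (h : ℕ → Set X), I.card = j + 1 ∧ (∀ i ∈ I, h i ∈ 𝒱 i) ∧
      W = ⋂ i ∈ I, h i}
  obtain ⟨W, hW, hWc⟩ := hX 𝒲
    (by
      rintro j _ ⟨I, h, -, hI, rfl⟩
      exact isOpen_biInter_finset fun i hi => ho i _ (hI i hi))
    (fun j => eq_univ_of_forall fun x => by
      obtain ⟨I, hI, hcard⟩ :=
        (Nat.frequently_atTop_iff_infinite.1 (hc x)).exists_subset_card_eq (j + 1)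
      have : ∀ i, ∃ V, i ∈ I → V ∈ 𝒱 i ∧ x ∈ V := fun i => by
        by_cases hi : i ∈ I
        · obtain ⟨V, hV⟩ := hI hi
          exact ⟨V, fun _ => hV⟩
        · exact ⟨∅, fun h => absurd h hi⟩
      choose h hh using this
      exact ⟨_, ⟨I, h, hcard, fun i hi => (hh i hi).1, rfl⟩, mem_iInter₂.2 fun i hi => (hh i hi).2⟩)
  choose I h hcard hI hWI using hW
  -- Hall's condition holds since the largest index `j` of `s` gives `s.card ≤ j + 1`
  obtain ⟨m, hinj, hm⟩ := (Finset.all_card_le_biUnion_card_iff_exists_injective I).1 fun s => by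
    rcases s.eq_empty_or_nonempty with rfl | hs
    · simp
    · calc s.card ≤ (Finset.range (s.max' hs + 1)).card := Finset.card_le_card fun i hi =>
            Finset.mem_range.2 (Nat.lt_succ_of_le (s.le_max' i hi))
        _ = (I (s.max' hs)).card := by rw [Finset.card_range, hcard]
        _ ≤ (s.biUnion I).card :=
            Finset.card_le_card (Finset.subset_biUnion_of_mem I (s.max'_mem hs))
  have hV : ∀ n, ∃ V ∈ 𝒱 n, ∀ j, m j = n → V = h j n := fun n => by
    by_cases hn : ∃ j, m j = n
    · obtain ⟨j, rfl⟩ := hn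
      exact ⟨h j (m j), hI j _ (hm j), fun j' hj' => by rw [hinj hj']⟩
    · obtain ⟨V, hV⟩ := hne n
      exact ⟨V, hV, fun j hj => absurd ⟨j, hj⟩ hn⟩
  choose V hV hVh using hV
  refine ⟨V, hV, fun x => ?_⟩
  obtain ⟨j, hj⟩ := hWc x
  rw [hWI j] at hj
  refine ⟨m j, ?_⟩
  rw [hVh _ j rfl]
  exact mem_iInter₂.1 hj _ (hm j)

/-- Pawlikowski's theorem, for a tree of countable open covers: some branch covers the space.

A bounding function `g` for the branch is found by Hurewicz's theorem, in such a way that each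
point `x` has infinitely many levels `n` on which *every* node below `g` has a successor of index
at most `g n` whose set contains `x`. The branch itself comes from selecting, on each level, one
successor for all these nodes at once. -/
theorem IsRothberger.exists_branch_mem (hX : IsRothberger X) {u : List ℕ → ℕ → Set X}
    (ho : ∀ s k, IsOpen (u s k)) (hc : ∀ s x, ∃ k, x ∈ u s k) :
    ∃ f : ℕ → ℕ, ∀ x, ∃ n, x ∈ u (initialSegment f n) (f n) := by
  have hfin : ∀ s : List ℕ, {t : List ℕ | List.Forall₂ (· ≤ ·) t s}.Finite := fun s => by
    induction s with
    | nil => exact (finite_singleton []).subset fun t ht => List.forall₂_nil_right_iff.1 ht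
    | cons a s ih =>
      refine ((finite_le_nat a).image2 List.cons ih).subset fun t ht => ?_
      obtain ⟨b, t', hb, ht', rfl⟩ := List.forall₂_cons_right_iff.1 ht
      exact mem_image2_of_mem hb ht'
  let T : List ℕ → Set (List ℕ) := fun s => {t | List.Forall₂ (· ≤ ·) t s}
  have hT : ∀ s, (T s).Finite := hfin
  obtain ⟨g, hg⟩ := hX.isMenger.exists_branch_frequently_mem
    (c := fun s k => ⋂ t ∈ T s, ⋃ j ≤ k, u t j)
    (fun s k => (hT s).isOpen_biInter fun t _ => isOpen_biUnion fun j _ => ho t j)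
    (fun s k l hkl => iInter₂_mono fun t _ => biUnion_mono (fun j hj => le_trans hj hkl)
      fun _ _ => le_rfl)
    (fun s x => by
      choose κ hκ using fun t => hc t x
      obtain ⟨k, hk⟩ := ((hT s).image κ).bddAbove
      exact ⟨k, mem_iInter₂.2 fun t ht =>
        mem_iUnion₂.2 ⟨κ t, hk (mem_image_of_mem κ ht), hκ t⟩⟩)
  obtain ⟨V, hV, hVc⟩ := hX.exists_selection_of_frequently
    (𝒱 := fun n => {V | ∃ φ : List ℕ → ℕ, (∀ t, φ t ≤ g n) ∧
      V = ⋂ t ∈ T (initialSegment g n), u t (φ t)})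
    (by
      rintro n _ ⟨φ, -, rfl⟩
      exact (hT _).isOpen_biInter fun t _ => ho t _)
    (fun n => ⟨_, fun _ => 0, fun _ => Nat.zero_le _, rfl⟩)
    (fun x => (hg x).mono fun n hn => by
      have : ∀ t, ∃ k ≤ g n, t ∈ T (initialSegment g n) → x ∈ u t k := fun t => by
        by_cases ht : t ∈ T (initialSegment g n)
        · obtain ⟨k, hk, hx⟩ := mem_iUnion₂.1 (mem_iInter₂.1 hn t ht)
          exact ⟨k, hk, fun _ => hx⟩
        · exact ⟨0, Nat.zero_le _, fun h => absurd h ht⟩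
      choose φ hφ hx using this
      exact ⟨_, ⟨φ, hφ, rfl⟩, mem_iInter₂.2 fun t ht => hx t ht⟩)
  choose φ hφ hVφ using hV
  obtain ⟨f, hf⟩ := exists_forall_eq_initialSegment fun s => φ s.length s
  have hf' : ∀ n, f n = φ n (initialSegment f n) := fun n => by
    rw [hf n, List.length_ofFn]
  have hfg : ∀ n, f n ≤ g n := fun n => hf' n ▸ hφ n _
  have hmem : ∀ n, initialSegment f n ∈ T (initialSegment g n) := fun n => by
    refine List.forall₂_iff_get.2 ⟨by simp, fun i h₁ h₂ => ?_⟩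
    simpa using hfg i
  refine ⟨f, fun x => ?_⟩
  obtain ⟨n, hn⟩ := hVc x
  rw [hVφ n] at hn
  have := mem_iInter₂.1 hn _ (hmem n)
  rw [← hf' n] at this
  exact ⟨n, this⟩

end Rothberger

/-! ### Selection principles and the two games -/

section Selection

variable {X : Type*} [TopologicalSpace X]

/-- A cover with `X` as a member makes the selection trivial, so it is enough to select from
non-trivial covers. -/
theorem isMenger_of_not_onePreWinsFin
    (h : ¬ OnePreWinsFin (nontrivialOpenCovers X) (nontrivialOpenCovers X)) : IsMenger X := by
  classical
  intro 𝒰 ho hc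
  by_cases hu : ∃ n, univ ∈ 𝒰 n
  · obtain ⟨n, hn⟩ := hu
    refine ⟨fun m => if m = n then {univ} else ∅, fun m => ?_, fun x => ⟨n, univ, by simp⟩⟩
    by_cases hm : m = n
    · simpa [hm] using hn
    · simp [hm]
  · have hσ : ∀ n, 𝒰 n ∈ nontrivialOpenCovers X := fun n => ⟨ho n, hc n, fun hn => hu ⟨n, hn⟩⟩
    have := not_exists.1 h fun n => ⟨𝒰 n, hσ n⟩
    push Not at this
    obtain ⟨F, hF, hFc⟩ := this
    refine ⟨F, hF, fun x => ?_⟩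
    obtain ⟨U, hU, hx⟩ := mem_sUnion.1 (hFc.2.1.symm ▸ mem_univ x)
    obtain ⟨n, hn⟩ := mem_iUnion.1 hU
    exact ⟨n, U, hn, hx⟩

/-- As for the Menger property, it is enough to select from non-trivial covers. -/
theorem isRothberger_of_not_onePreWinsSingle [Nonempty X]
    (h : ¬ OnePreWinsSingle (nontrivialOpenCovers X) (nontrivialOpenCovers X)) :
    IsRothberger X := by
  intro 𝒰 ho hc
  by_cases hu : ∃ n, univ ∈ 𝒰 n
  · obtain ⟨n, hn⟩ := hu
    have hne : ∀ m, ∃ V ∈ 𝒰 m, m = n → V = univ := fun m => by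
      by_cases hm : m = n
      · exact ⟨univ, hm ▸ hn, fun _ => rfl⟩
      · obtain ⟨V, hV, -⟩ := mem_sUnion.1 ((hc m).symm ▸ mem_univ (Classical.arbitrary X))
        exact ⟨V, hV, fun h => absurd h hm⟩
    choose V hV hVn using hne
    exact ⟨V, hV, fun x => ⟨n, hVn n rfl ▸ mem_univ x⟩⟩
  · have hσ : ∀ n, 𝒰 n ∈ nontrivialOpenCovers X := fun n => ⟨ho n, hc n, fun hn => hu ⟨n, hn⟩⟩
    have := not_exists.1 h fun n => ⟨𝒰 n, hσ n⟩
    push Not at this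
    obtain ⟨V, hV, hVc⟩ := this
    refine ⟨V, hV, fun x => ?_⟩
    obtain ⟨_, ⟨n, rfl⟩, hx⟩ := mem_sUnion.1 (hVc.2.1.symm ▸ mem_univ x)
    exact ⟨n, hx⟩

end Selection

section Strategies

variable {α : Type*} {𝒜 ℬ : Set (Set α)}

theorem OnePreWinsSingle.oneWinsSingle (h : OnePreWinsSingle 𝒜 ℬ) : OneWinsSingle 𝒜 ℬ := by
  obtain ⟨σ, hσ⟩ := h
  exact ⟨fun s => σ s.length, fun x hx => hσ _ fun n => by simpa using hx n⟩

theorem OnePreWinsFin.oneWinsFin (h : OnePreWinsFin 𝒜 ℬ) : OneWinsFin 𝒜 ℬ := by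
  obtain ⟨σ, hσ⟩ := h
  exact ⟨fun s => σ s.length, fun F hF => hσ _ fun n => by simpa using hF n⟩

end Strategies

section Theorems

variable {X : Type*} [TopologicalSpace X]

/-- In a nonempty Menger space, any strategy of One in the finite-selection game is defeated by
Two, who answers each cover with an initial part of an enumerated countable subcover. -/
theorem IsMenger.not_oneWinsFin [Nonempty X] (hX : IsMenger X) :
    ¬ OneWinsFin (nontrivialOpenCovers X) (nontrivialOpenCovers X) := by
  classical
  rintro ⟨σ, hσ⟩
  choose e he hec using fun A : nontrivialOpenCovers X => hX.exists_seq_mem A.2.1 A.2.2.1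
  have hsub : ∀ A k, (((Finset.range (k + 1)).image (e A) : Finset (Set X)) : Set (Set X)) ⊆ A :=
    fun A k => by
      intro U hU
      obtain ⟨j, -, rfl⟩ := Finset.mem_image.1 hU
      exact he A j
  let next : List (FiniteMove (nontrivialOpenCovers X)) → ℕ →
      FiniteMove (nontrivialOpenCovers X) :=
    fun l k => ⟨(Finset.range (k + 1)).image (e (σ l)), σ l, (σ l).2, hsub (σ l) k⟩
  obtain ⟨f, hf⟩ := hX.exists_branch_frequently_mem
    (c := fun s k => ⋃ j ≤ k, e (σ (decodeHistory next s)) j)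
    (fun s k => isOpen_biUnion fun j _ => (σ (decodeHistory next s)).2.1 _ (he _ j))
    (fun s k l hkl => biUnion_mono (fun j hj => le_trans hj hkl) fun _ _ => le_rfl)
    (fun s x => by
      obtain ⟨k, hk⟩ := hec (σ (decodeHistory next s)) x
      exact ⟨k, mem_iUnion₂.2 ⟨k, le_rfl, hk⟩⟩)
  let F : ℕ → FiniteMove (nontrivialOpenCovers X) := fun n =>
    next (decodeHistory next (initialSegment f n)) (f n)
  have hF : ∀ n, ((F n).1 : Set (Set X)) ⊆ σ (initialSegment F n) := fun n => by
    rw [initialSegment_decodeHistory]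
    exact hsub _ _
  refine hσ F hF ⟨fun U hU => ?_, eq_univ_of_forall fun x => ?_, fun hU => ?_⟩
  · obtain ⟨n, hn⟩ := mem_iUnion.1 hU
    exact (σ _).2.1 U (hF n hn)
  · obtain ⟨n, hn⟩ := (hf x).exists
    obtain ⟨j, hj, hx⟩ := mem_iUnion₂.1 hn
    exact ⟨_, mem_iUnion.2 ⟨n, Finset.mem_coe.2 (Finset.mem_image_of_mem _
      (Finset.mem_range.2 (Nat.lt_succ_of_le hj)))⟩, hx⟩
  · obtain ⟨n, hn⟩ := mem_iUnion.1 hU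
    exact (σ _).2.2.2 (hF n hn)

/-- In a nonempty Rothberger space, Two defeats any strategy of One in the single-selection game by
following a covering branch through the tree of countable subcovers. -/
theorem IsRothberger.not_oneWinsSingle [Nonempty X] (hX : IsRothberger X) :
    ¬ OneWinsSingle (nontrivialOpenCovers X) (nontrivialOpenCovers X) := by
  rintro ⟨σ, hσ⟩
  choose e he hec using fun A : nontrivialOpenCovers X =>
    hX.isMenger.exists_seq_mem A.2.1 A.2.2.1
  let next : List (⋃₀ nontrivialOpenCovers X : Set (Set X)) → ℕ →
      (⋃₀ nontrivialOpenCovers X : Set (Set X)) :=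
    fun l k => ⟨e (σ l) k, σ l, (σ l).2, he (σ l) k⟩
  obtain ⟨f, hf⟩ := hX.exists_branch_mem (u := fun s k => e (σ (decodeHistory next s)) k)
    (fun s k => (σ (decodeHistory next s)).2.1 _ (he _ k)) fun s x => hec _ x
  let V : ℕ → (⋃₀ nontrivialOpenCovers X : Set (Set X)) := fun n =>
    next (decodeHistory next (initialSegment f n)) (f n)
  have hV : ∀ n, (V n : Set X) ∈ (σ (initialSegment V n) : Set (Set X)) := fun n => by
    rw [initialSegment_decodeHistory]
    exact he _ _
  refine hσ V hV ⟨?_, eq_univ_of_forall fun x => ?_, ?_⟩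
  · rintro _ ⟨n, rfl⟩
    exact (σ _).2.1 _ (hV n)
  · obtain ⟨n, hn⟩ := hf x
    exact ⟨_, mem_range_self n, hn⟩
  · rintro ⟨n, hn⟩
    exact (σ (initialSegment V n)).2.2.2 (hn ▸ hV n)

theorem onePreWinsFin_iff_oneWinsFin :
    OnePreWinsFin (nontrivialOpenCovers X) (nontrivialOpenCovers X) ↔
      OneWinsFin (nontrivialOpenCovers X) (nontrivialOpenCovers X) := by
  refine ⟨OnePreWinsFin.oneWinsFin, fun h => ?_⟩
  by_contra hpre
  cases isEmpty_or_nonempty X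
  · -- on the empty space, Two wins by always selecting nothing
    obtain ⟨σ, hσ⟩ := h
    refine hσ (fun _ => ⟨∅, σ [], (σ []).2, by simp⟩) (fun n => by simp) ?_
    simp [nontrivialOpenCovers, eq_iff_true_of_subsingleton]
  · exact (isMenger_of_not_onePreWinsFin hpre).not_oneWinsFin h

theorem onePreWinsSingle_iff_oneWinsSingle :
    OnePreWinsSingle (nontrivialOpenCovers X) (nontrivialOpenCovers X) ↔
      OneWinsSingle (nontrivialOpenCovers X) (nontrivialOpenCovers X) := by
  refine ⟨OnePreWinsSingle.oneWinsSingle, fun h => ?_⟩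
  cases isEmpty_or_nonempty X
  · -- on the empty space, One plays the empty cover, from which nothing can be selected
    refine ⟨fun _ => ⟨∅, by simp [nontrivialOpenCovers, eq_iff_true_of_subsingleton]⟩,
      fun x hx => absurd (hx 0) (notMem_empty _)⟩
  · by_contra hpre
    exact (isRothberger_of_not_onePreWinsSingle hpre).not_oneWinsSingle h

end Theorems

theorem mainTheorem3 (X : Type*) [TopologicalSpace X] [T2Space X] [ParacompactSpace X] :
    (OnePreWinsSingle (nontrivialOpenUniformCovers (universalUniformity X))
        (nontrivialOpenCovers X) ↔
      OneWinsSingle (nontrivialOpenUniformCovers (universalUniformity X))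
        (nontrivialOpenCovers X)) ∧
    (OnePreWinsFin (nontrivialOpenUniformCovers (universalUniformity X))
        (nontrivialOpenCovers X) ↔
      OneWinsFin (nontrivialOpenUniformCovers (universalUniformity X))
        (nontrivialOpenCovers X)) := by
  rw [nontrivialOpenUniformCovers_universalUniformity]
  exact ⟨onePreWinsSingle_iff_oneWinsSingle, onePreWinsFin_iff_oneWinsFin⟩
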